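/- Let $V$ be a finite-dimensional Euclidean vector space and let $\mathfrak h\subseteq\mathfrak{so}(V)$ be a Lie subalgebra acting irreducibly on $V$ (the action is automatically faithful). Let $\operatorname{Sym}^2\Lambda^2V$ be the space of 4-tensors on $V$ that are skew-symmetric in the first two arguments, skew-symmetric in the last two arguments and symmetric under exchange of these two pairs, and let $\mathcal K\subseteq\operatorname{Sym}^2\Lambda^2V$ be the space of algebraic curvature tensors, i.e. those $R$ with $$R(X,Y,Z,W)+R(Y,Z,X,W)+R(Z,X,Y,W)=0\qquad\text{for all }X,Y,Z,W\in V.$$ Let $\operatorname{Sym}\mathfrak h\subseteq\operatorname{Sym}^2\Lambda^2V$ be the subspace of symmetric endomorphisms of $\mathfrak h\subseteq\mathfrak{so}(V)\cong\Lambda^2V$, i.e. of those $R$ such that for all $X,Y\in V$ the endomorphism $R(X,Y)$ of $V$ defined by $\langle R(X,Y)Z,W\rangle=R(X,Y,Z,W)$ lies in $\mathfrak h$, and let $\mathcal K(\mathfrak h)=\mathcal K\cap\operatorname{Sym}\mathfrak h$, the representation of $\mathfrak h$ on algebraic curvature tensors with values in $\mathfrak h$. Suppose that $(V\otimes\mathfrak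 h)^{\mathfrak h}\neq0$. Then: 1. $\mathfrak h$ is simple, and $V\cong\mathfrak h$ as representations of $\mathfrak h$, where $\mathfrak h$ carries the adjoint representation. 2. If $\mathfrak h$ has rank at least $2$, then $\mathcal K(\mathfrak h)\cong\mathbb R$, the one-dimensional trivial representation. 3. If $\mathfrak h\cong\mathfrak{so}(3)$, then $\mathcal K(\mathfrak h)=\mathcal K$, and $\mathcal K(\mathfrak h)\cong\operatorname{Sym}^2\mathbb R^3$ as representations of $\mathfrak h\cong\mathfrak{so}(3)$. 4. Let $\varphi:V\to\mathfrak h$ be any isomorphism of representations of $\mathfrak h$, and let $\tau\in(V\otimes\mathfrak h)^{\mathfrak h}\subseteq(V\otimes\mathfrak{so}(V))^{\mathfrak h}$, regarded as the 3-tensor $\tau(X,Y,Z)=\langle\tau_XY,Z\rangle$, where $(v\otimes A)_X=\langle v,X\rangle A$. Then $\tau$ is a real multiple of the canonical 3-form $(X,Y,Z)\mapsto\langle\varphi^{-1}[\varphi X,\varphi Y],Z\rangle$ given by the Lie bracket of $\mathfrak h$; in particular $\tau$ is totally skew-symmetric. -/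

import Mathlib

open scoped TensorProduct RealInnerProductSpace

attribute [local instance 100] LieRing.ofAssociativeRing

namespace SkewCurv

section Orthogonal

variable (V : Type*) [NormedAddCommGroup V] [InnerProductSpace ℝ V]

/-- The Lie algebra `so(V)` of skew-symmetric endomorphisms of a Euclidean vector space `V`. -/
noncomputable abbrev so : LieSubalgebra ℝ (Module.End ℝ V) :=
  skewAdjointLieSubalgebra (innerₗ V)

variable {V}

theorem inner_so (x : so V) (Y Z : V) : ⟪⁅x, Y⁆, Z⟫ = -⟪Y, ⁅x, Z⁆⟫ := by
  have h := (LinearMap.mem_skewAdjointSubmodule (B := innerₗ V) (f := (x : Module.End ℝ V))).1 x.2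
  have h2 : ⟪(x : Module.End ℝ V) Y, Z⟫ = ⟪Y, -((x : Module.End ℝ V) Z)⟫ := h Y Z
  rw [inner_neg_right] at h2
  exact h2

end Orthogonal

section SymmetricSquare

variable (L M : Type*) [LieRing L] [LieAlgebra ℝ L] [AddCommGroup M] [Module ℝ M]
  [LieRingModule L M] [LieModule ℝ L M]

/-- The symmetric square `Sym² M` of a real representation `M` of `L`, realized as the
subrepresentation of symmetric tensors in `M ⊗ M`. -/
def symSq : LieSubmodule ℝ L (M ⊗[ℝ] M) where
  toSubmodule := LinearMap.eqLocus (TensorProduct.comm ℝ M M).toLinearMap LinearMap.id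
  lie_mem := by
    intro x t ht
    have key : ∀ s : M ⊗[ℝ] M,
        TensorProduct.comm ℝ M M ⁅x, s⁆ = ⁅x, TensorProduct.comm ℝ M M s⁆ := by
      intro s
      induction s using TensorProduct.induction_on with
      | zero => simp
      | tmul a b => simp [TensorProduct.LieModule.lie_tmul_right, add_comm]
      | add a b ha hb => simp [lie_add, ha, hb]
    have ht' : TensorProduct.comm ℝ M M t = t := ht
    show TensorProduct.comm ℝ M M ⁅x, t⁆ = ⁅x, t⁆
    rw [key, ht']

end SymmetricSquare

section Curvature

variable (V : Type*) [NormedAddCommGroup V] [InnerProductSpace ℝ V]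

/-- Covariant `4`-tensors on `V`. Using the metric to raise the last index, such a tensor is
written as a trilinear map `(X, Y, Z) ↦ R X Y Z ∈ V`, and the value of the tensor on
`(X, Y, Z, W)` is `⟪R X Y Z, W⟫`. The algebra `so(V)` acts by
`(x • R) X Y Z = x (R X Y Z) - R (x X) Y Z - R X (x Y) Z - R X Y (x Z)`. -/
abbrev Tensor4 : Type _ := V →ₗ[ℝ] V →ₗ[ℝ] V →ₗ[ℝ] V

variable {V}

theorem lie_tensor4_apply (x : so V) (R : Tensor4 V) (X Y Z : V) :
    ⁅x, R⁆ X Y Z = ⁅x, R X Y Z⁆ - R ⁅x, X⁆ Y Z - R X ⁅x, Y⁆ Z - R X Y ⁅x, Z⁆ := by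
  simp only [LieHom.lie_apply, LinearMap.sub_apply]
  abel

/-- The Bianchi map: the cyclic sum in the first three arguments. -/
def bianchi (R : Tensor4 V) (X Y Z : V) : V := R X Y Z + R Y Z X + R Z X Y

variable (V)

/-- The space `Sym² Λ² V`: the `4`-tensors which are skew-symmetric in the first pair of
arguments, skew-symmetric in the second pair, and symmetric under exchange of the two pairs. -/
def symSqLambda : LieSubmodule ℝ (so V) (Tensor4 V) where
  carrier := {R | (∀ X Y Z W, ⟪R X Y Z, W⟫ = -⟪R Y X Z, W⟫) ∧
    (∀ X Y Z W, ⟪R X Y Z, W⟫ = -⟪R X Y W, Z⟫) ∧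
    (∀ X Y Z W, ⟪R X Y Z, W⟫ = ⟪R Z W X, Y⟫)}
  zero_mem' := by simp
  add_mem' := by
    rintro R S ⟨a, b, c⟩ ⟨a', b', c'⟩
    refine ⟨fun X Y Z W => ?_, fun X Y Z W => ?_, fun X Y Z W => ?_⟩ <;>
      simp only [LinearMap.add_apply, inner_add_left]
    · rw [a, a']; ring
    · rw [b, b']; ring
    · rw [c, c']
  smul_mem' := by
    rintro t R ⟨a, b, c⟩
    refine ⟨fun X Y Z W => ?_, fun X Y Z W => ?_, fun X Y Z W => ?_⟩ <;>
      simp only [LinearMap.smul_apply, inner_smul_left]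
    · rw [a]; ring
    · rw [b]; ring
    · rw [c]
  lie_mem := by
    rintro x R ⟨a, b, c⟩
    refine ⟨fun X Y Z W => ?_, fun X Y Z W => ?_, fun X Y Z W => ?_⟩ <;>
      simp only [lie_tensor4_apply, inner_sub_left, inner_so]
    · linarith [a X Y Z ⁅x, W⁆, a ⁅x, X⁆ Y Z W, a X ⁅x, Y⁆ Z W, a X Y ⁅x, Z⁆ W]
    · linarith [b X Y Z ⁅x, W⁆, b ⁅x, X⁆ Y Z W, b X ⁅x, Y⁆ Z W, b X Y ⁅x, Z⁆ W]
    · linarith [c X Y Z ⁅x, W⁆, c ⁅x, X⁆ Y Z W, c X ⁅x, Y⁆ Z W, c X Y ⁅x, Z⁆ W]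

/-- The space `𝒦` of algebraic curvature tensors on `V`: the kernel of the Bianchi map on
`Sym² Λ² V`. -/
def curv : LieSubmodule ℝ (so V) (Tensor4 V) where
  carrier := {R | R ∈ symSqLambda V ∧ ∀ X Y Z, bianchi R X Y Z = 0}
  zero_mem' := ⟨zero_mem _, by simp [bianchi]⟩
  add_mem' := by
    rintro R S ⟨a, b⟩ ⟨a', b'⟩
    refine ⟨add_mem a a', fun X Y Z => ?_⟩
    have : bianchi (R + S) X Y Z = bianchi R X Y Z + bianchi S X Y Z := by
      simp only [bianchi, LinearMap.add_apply]; abel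
    rw [this, b, b', add_zero]
  smul_mem' := by
    rintro t R ⟨a, b⟩
    refine ⟨(symSqLambda V).smul_mem t a, fun X Y Z => ?_⟩
    have : bianchi (t • R) X Y Z = t • bianchi R X Y Z := by
      simp only [bianchi, LinearMap.smul_apply, smul_add]
    rw [this, b, smul_zero]
  lie_mem := by
    rintro x R ⟨a, b⟩
    refine ⟨(symSqLambda V).lie_mem a, fun X Y Z => ?_⟩
    have : bianchi ⁅x, R⁆ X Y Z = ⁅x, bianchi R X Y Z⁆ - bianchi R ⁅x, X⁆ Y Z
        - bianchi R X ⁅x, Y⁆ Z - bianchi R X Y ⁅x, Z⁆ := by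
      simp only [bianchi, lie_tensor4_apply, lie_add]; abel
    rw [this, b, b, b, b]; simp

variable {V}

/-- The space `Sym 𝔥` of symmetric endomorphisms of a subalgebra `𝔥 ⊆ so(V)`, viewed inside
`Sym² Λ² V`. An element of `Sym² Λ² V` is a symmetric endomorphism `X ∧ Y ↦ R X Y` of
`so(V) ≅ Λ² V`; the symmetric endomorphisms of `𝔥` (extended by zero to `𝔥^⊥`) are exactly those
with image in `𝔥`, i.e. with `R X Y ∈ 𝔥` for all `X, Y`. -/
def symOf (h : LieSubalgebra ℝ (so V)) : LieSubmodule ℝ h (Tensor4 V) where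
  carrier := {R | R ∈ symSqLambda V ∧
    ∀ X Y, ∃ A ∈ h, ∀ Z, R X Y Z = (A : Module.End ℝ V) Z}
  zero_mem' := ⟨zero_mem _, fun _ _ => ⟨0, zero_mem _, by simp⟩⟩
  add_mem' := by
    rintro R S ⟨a, b⟩ ⟨a', b'⟩
    refine ⟨add_mem a a', fun X Y => ?_⟩
    obtain ⟨A, hA, hR⟩ := b X Y
    obtain ⟨B, hB, hS⟩ := b' X Y
    exact ⟨A + B, add_mem hA hB, fun Z => by simp [hR, hS]⟩
  smul_mem' := by
    rintro t R ⟨a, b⟩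
    refine ⟨(symSqLambda V).smul_mem t a, fun X Y => ?_⟩
    obtain ⟨A, hA, hR⟩ := b X Y
    exact ⟨t • A, h.smul_mem t hA, fun Z => by simp [hR]⟩
  lie_mem := by
    rintro x R ⟨a, b⟩
    refine ⟨(symSqLambda V).lie_mem (x := (x : so V)) a, fun X Y => ?_⟩
    obtain ⟨A, hA, hR⟩ := b X Y
    obtain ⟨B, hB, hS⟩ := b ⁅(x : so V), X⁆ Y
    obtain ⟨C, hC, hT⟩ := b X ⁅(x : so V), Y⁆
    refine ⟨⁅(x : so V), A⁆ - B - C, sub_mem (sub_mem (h.lie_mem x.2 hA) hB) hC, fun Z => ?_⟩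
    have e : ⁅x, R⁆ X Y Z = ⁅(x : so V), R⁆ X Y Z := rfl
    rw [e, lie_tensor4_apply, hR, hR, hS, hT]
    have e2 : ((⁅(x : so V), A⁆ - B - C : so V) : Module.End ℝ V) Z
        = ⁅(x : so V), (A : Module.End ℝ V) Z⁆ - (A : Module.End ℝ V) ⁅(x : so V), Z⁆
          - (B : Module.End ℝ V) Z - (C : Module.End ℝ V) Z := rfl
    rw [e2]; abel

/-- The space `𝒦(𝔥) = 𝒦 ∩ Sym 𝔥` of algebraic curvature tensors with values in `𝔥`, as a
representation of `𝔥`. -/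
def curvOf (h : LieSubalgebra ℝ (so V)) : LieSubmodule ℝ h (Tensor4 V) where
  toSubmodule := (curv V).toSubmodule ⊓ (symOf h).toSubmodule
  lie_mem := by
    rintro x R ⟨a, b⟩
    exact ⟨(curv V).lie_mem (x := (x : so V)) a, (symOf h).lie_mem b⟩

end Curvature

section ThreeForm

variable {V : Type*} [NormedAddCommGroup V] [InnerProductSpace ℝ V]

/-- The contraction `V ⊗ 𝔥 → Hom(V, 𝔥)`, `τ ↦ (X ↦ τ_X)`, with `(v ⊗ A)_X = ⟪v, X⟫ A`, given by the
identification of `V` with its dual. -/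
noncomputable def contract (h : LieSubalgebra ℝ (so V)) : V ⊗[ℝ] h →ₗ[ℝ] V →ₗ[ℝ] h :=
  TensorProduct.lift ((LinearMap.smulRightₗ : (V →ₗ[ℝ] ℝ) →ₗ[ℝ] h →ₗ[ℝ] V →ₗ[ℝ] h) ∘ₗ innerₗ V)

theorem contract_tmul (h : LieSubalgebra ℝ (so V)) (v X : V) (A : h) :
    contract h (v ⊗ₜ A) X = ⟪v, X⟫ • A := by
  simp [contract]

/-- The covariant `3`-tensor `τ(X, Y, Z) = ⟪τ_X Y, Z⟫` corresponding to
`τ ∈ V ⊗ 𝔥 ⊆ V ⊗ so(V)`. -/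
noncomputable def tensor3 (h : LieSubalgebra ℝ (so V)) (τ : V ⊗[ℝ] h) (X Y Z : V) : ℝ :=
  ⟪⁅contract h τ X, Y⁆, Z⟫

/-- The bracket of `𝔥` transported to `V` along an isomorphism `φ : V ≅ 𝔥` of representations. -/
theorem symm_lie (h : LieSubalgebra ℝ (so V)) (φ : V ≃ₗ⁅ℝ, h⁆ h) (X Y : V) :
    φ.symm ⁅φ X, φ Y⁆ = ⁅φ X, Y⁆ := by
  have : ⁅φ X, φ Y⁆ = φ ⁅φ X, Y⁆ := (LieModuleHom.map_lie φ.toLieModuleHom (φ X) Y).symm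
  rw [this]
  exact φ.symm_apply_apply _

/-- The canonical `3`-form `⟨[·,·],·⟩` given by the Lie bracket of `𝔥`, on the vector space `V`
identified with `𝔥` by an isomorphism `φ : V ≅ 𝔥` of representations of `𝔥`. -/
noncomputable def canonicalForm (h : LieSubalgebra ℝ (so V)) (φ : V ≃ₗ⁅ℝ, h⁆ h) :
    V [⋀^Fin 3]→ₗ[ℝ] ℝ where
  toFun v := ⟪φ.symm ⁅φ (v 0), φ (v 1)⁆, v 2⟫
  map_update_add' := by
    intro inst m i x y
    cases Subsingleton.elim inst (instDecidableEqFin 3)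
    fin_cases i <;> simp [Function.update, inner_add_left, inner_add_right]
  map_update_smul' := by
    intro inst m i c x
    cases Subsingleton.elim inst (instDecidableEqFin 3)
    fin_cases i <;> simp [Function.update, inner_smul_left, inner_smul_right]
  map_eq_zero_of_eq' := by
    intro v i j hij hne
    have h01 : ∀ X Z : V, ⟪φ.symm ⁅φ X, φ X⁆, Z⟫ = 0 := by intro X Z; simp
    have h12 : ∀ X Y : V, ⟪φ.symm ⁅φ X, φ Y⁆, Y⟫ = 0 := by
      intro X Y
      have := inner_so (φ X : so V) Y Y
      rw [symm_lie]
      have e : ⁅φ X, Y⁆ = ⁅(φ X : so V), Y⁆ := rfl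
      rw [e]
      rw [real_inner_comm Y] at this
      rw [real_inner_comm]
      linarith
    have h02 : ∀ X Y : V, ⟪φ.symm ⁅φ X, φ Y⁆, X⟫ = 0 := by
      intro X Y
      have e : φ.symm ⁅φ X, φ Y⁆ = -φ.symm ⁅φ Y, φ X⁆ := by
        rw [← lie_skew (φ X) (φ Y)]
        exact map_neg φ.symm _
      rw [e, inner_neg_left, h12, neg_zero]
    fin_cases i <;> fin_cases j <;> simp at hij hne ⊢ <;> simp [hij, h12, h02]

theorem canonicalForm_apply (h : LieSubalgebra ℝ (so V)) (φ : V ≃ₗ⁅ℝ, h⁆ h) (X Y Z : V) :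
    canonicalForm h φ ![X, Y, Z] = ⟪φ.symm ⁅φ X, φ Y⁆, Z⟫ := rfl

end ThreeForm

end SkewCurv

/-!
An invariant element `τ ≠ 0` of `V ⊗ 𝔥` is a nonzero morphism `V → 𝔥` of representations. It is
injective by irreducibility. An element of `𝔥` orthogonal to its range annihilates `V`, so it is an
isomorphism and `𝔥` is simple. Every endomorphism of the adjoint representation is self-adjoint, so
by Schur's lemma `τ` is a multiple of the bracket.

Transporting the inner product of `V` to `𝔥`, the elements of `Sym 𝔥` are the tensors
`(x, y, z) ↦ ⁅S ⁅x, y⁆, z⁆` for self-adjoint endomorphisms `S` of `𝔥`. Let `𝔱` be a maximal abelian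
subspace. For `x ∈ 𝔱` commuting with `y` but not with the root vector `z`, the Bianchi identity for
`y`, `⁅w, y⁆`, `x` makes `S z` orthogonal to `⁅y, ⁅w, y⁆⁆` for every `w ∈ 𝔱`. If `𝔥` has rank at
least `2`, such elements `x` show that the projection of `S z` to `𝔱` vanishes. Therefore `S x` is
orthogonal to `⁅x, 𝔥⁆`, that is, `⁅S x, x⁆ = 0` for all `x`; hence `S` is equivariant and, by
Schur's lemma, scalar.

If `𝔥 ≅ so(3)`, then `V` has dimension `3` and `𝔥 = so(V)`. The Bianchi sum of an element of
`Sym² Λ² V` is an alternating `4`-form, so it vanishes, and `K(𝔥) = Sym 𝔥` is the symmetric square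
of `𝔥 ≅ ℝ³`.
-/

namespace SkewCurv

/-! ### Invariant inner products -/

section InvariantInner

variable {L M : Type*} [LieRing L] [AddCommGroup M] [Module ℝ M] [LieRingModule L M]

variable (L) in
/-- `β` is an inner product on the real representation `M` of `L` for which `L` acts by
skew-symmetric endomorphisms. It is a predicate on bilinear forms, rather than an
`InnerProductSpace` structure, because it will be used on Lie algebras of endomorphisms, which have
no preferred norm. -/
structure IsInvariantInner (β : LinearMap.BilinForm ℝ M) : Prop where
  isSymm : β.IsSymm
  pos : ∀ x ≠ 0, 0 < β x x
  lieInvariant : β.lieInvariant L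

namespace IsInvariantInner

variable {β : LinearMap.BilinForm ℝ M}

section Form

variable (hβ : IsInvariantInner L β)
include hβ

theorem eq_zero_of_self {x : M} (hx : β x x = 0) : x = 0 :=
  by_contra fun h => (hβ.pos x h).ne' hx

theorem ext {x y : M} (h : ∀ z, β x z = β y z) : x = y :=
  sub_eq_zero.1 <| hβ.eq_zero_of_self <| by
    rw [map_sub β, LinearMap.sub_apply, h, sub_self]

theorem nondegenerate : β.Nondegenerate :=
  (hβ.isSymm.isRefl.nondegenerate_iff_separatingLeft).2 fun x hx => hβ.eq_zero_of_self (hx x)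

theorem comp {N : Type*} [AddCommGroup N] [Module ℝ N] [LieRingModule L N] {ι : N →ₗ[ℝ] M}
    (hι : Function.Injective ι) (hlie : ∀ (x : L) n, ι ⁅x, n⁆ = ⁅x, ι n⁆) :
    IsInvariantInner L (β.compl₁₂ ι ι) where
  isSymm := ⟨fun x y => hβ.isSymm.eq (ι x) (ι y)⟩
  pos x hx := hβ.pos (ι x) ((map_ne_zero_iff ι hι).2 hx)
  lieInvariant x y z := by simp [hlie, hβ.lieInvariant x (ι y) (ι z)]

variable [FiniteDimensional ℝ M]

theorem isCompl_orthogonal (W : Submodule ℝ M) : IsCompl W (β.orthogonal W) :=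
  (LinearMap.BilinForm.isCompl_orthogonal_iff_disjoint hβ.isSymm.isRefl).2 <|
    Submodule.disjoint_def.2 fun x hx hxW => hβ.eq_zero_of_self (hxW x hx)

theorem exists_mem_apply_eq (W : Submodule ℝ M) (x : M) : ∃ u ∈ W, ∀ w ∈ W, β x w = β u w := by
  obtain ⟨u, hu, v, hv, rfl⟩ := (Submodule.mem_sup (p := W) (p' := β.orthogonal W)).1
    ((hβ.isCompl_orthogonal W).sup_eq_top ▸ Submodule.mem_top : x ∈ _)
  refine ⟨u, hu, fun w hw => ?_⟩
  rw [map_add, LinearMap.add_apply, hβ.isSymm.eq v w, hv w hw, add_zero]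

theorem iSup_iInf_eigenspace_eq_top {ι : Type*} {T : ι → Module.End ℝ M}
    (hT : ∀ i, β.IsSelfAdjoint (T i)) (hcomm : ∀ i j, Commute (T i) (T j)) :
    ⨆ χ : ι → ℝ, ⨅ i, Module.End.eigenspace (T i) (χ i) = ⊤ := by
  let core : InnerProductSpace.Core ℝ M :=
    { inner := fun x y => β x y
      conj_inner_symm := fun x y => hβ.isSymm.eq y x
      re_inner_nonneg := fun x => by
        rcases eq_or_ne x 0 with rfl | hx
        · simp
        · exact (hβ.pos x hx).le
      add_left := fun x y z => by simp
      smul_left := fun x y c => by simp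
      definite := fun x hx => hβ.eq_zero_of_self hx }
  let : NormedAddCommGroup M := core.toNormedAddCommGroup
  let : InnerProductSpace ℝ M := InnerProductSpace.ofCore core.toCore
  exact LinearMap.IsSymmetric.iSup_iInf_eq_top_of_commute (T := T) hT fun i j _ => hcomm i j

theorem exists_hasEigenvalue [Nontrivial M] {f : Module.End ℝ M} (hf : β.IsSelfAdjoint f) :
    ∃ c, f.HasEigenvalue c := by
  have htop := hβ.iSup_iInf_eigenspace_eq_top (ι := Unit) (T := fun _ => f) (fun _ => hf)
    fun _ _ => Commute.refl f
  by_contra! hne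
  refine bot_ne_top (α := Submodule ℝ M) (htop ▸ (iSup_eq_bot.2 fun χ => ?_).symm)
  simpa [Module.End.hasEigenvalue_iff] using hne (χ ())

end Form

theorem exists_eq_smul_of_isSelfAdjoint [LieAlgebra ℝ L] [LieModule ℝ L M] [FiniteDimensional ℝ M]
    [LieModule.IsIrreducible ℝ L M] (hβ : IsInvariantInner L β) {f : M →ₗ⁅ℝ, L⁆ M}
    (hf : β.IsSelfAdjoint f) : ∃ c : ℝ, ∀ x, f x = c • x := by
  have := LieModule.nontrivial_of_isIrreducible ℝ L M
  obtain ⟨c, hc⟩ := hβ.exists_hasEigenvalue (f := (f : Module.End ℝ M)) hf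
  obtain ⟨x, hx⟩ := hc.exists_hasEigenvector
  have hker : (f - c • LieModuleHom.id).ker = ⊤ :=
    (eq_bot_or_eq_top _).resolve_left fun hbot => hx.2 <| (LieSubmodule.mem_bot x).1 <| by
      rw [← hbot, LieModuleHom.mem_ker]
      simpa [sub_eq_zero] using hx.apply_eq_smul
  refine ⟨c, fun y => ?_⟩
  have hy : y ∈ (f - c • LieModuleHom.id).ker := hker ▸ LieSubmodule.mem_top y
  simpa [LieModuleHom.mem_ker, sub_eq_zero] using hy

end IsInvariantInner

end InvariantInner

/-! ### Maximal abelian subspaces and weight vectors -/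

section SelfCentralizing

variable {R L : Type*} [CommRing R] [LieRing L] [LieAlgebra R L]

/-- A submodule of a Lie algebra is self-centralizing if it equals its own centralizer, that is, if
it is a maximal abelian submodule. -/
def IsSelfCentralizing (t : Submodule R L) : Prop :=
  ∀ y, y ∈ t ↔ ∀ x ∈ t, ⁅x, y⁆ = 0

theorem IsSelfCentralizing.lie_eq_zero {t : Submodule R L} (ht : IsSelfCentralizing t) {x y : L}
    (hx : x ∈ t) (hy : y ∈ t) : ⁅x, y⁆ = 0 :=
  (ht y).1 hy x hx

theorem lie_lie_comm_of_lie_eq_zero {x y : L} (hxy : ⁅x, y⁆ = 0) (z : L) :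
    ⁅x, ⁅y, z⁆⁆ = ⁅y, ⁅x, z⁆⁆ := by
  rw [leibniz_lie, hxy, zero_lie, zero_add]

theorem lie_eq_zero_of_mem_sup_span_singleton {t : Submodule R L}
    (ht : ∀ x ∈ t, ∀ y ∈ t, ⁅x, y⁆ = 0) {y : L} (hy : ∀ x ∈ t, ⁅x, y⁆ = 0) :
    ∀ v ∈ t ⊔ R ∙ y, ∀ w ∈ t ⊔ R ∙ y, ⁅v, w⁆ = 0 := by
  intro v hv w hw
  obtain ⟨p, hp, _, ha, rfl⟩ := Submodule.mem_sup.1 hv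
  obtain ⟨q, hq, _, hb, rfl⟩ := Submodule.mem_sup.1 hw
  obtain ⟨a, rfl⟩ := Submodule.mem_span_singleton.1 ha
  obtain ⟨b, rfl⟩ := Submodule.mem_span_singleton.1 hb
  have hyq : ⁅y, q⁆ = 0 := by rw [← lie_skew, hy q hq, neg_zero]
  simp [ht p hp q hq, hy p hp, hyq]

theorem exists_isSelfCentralizing [IsNoetherian R L] (x : L) :
    ∃ t : Submodule R L, x ∈ t ∧ IsSelfCentralizing t := by
  obtain ⟨t, hxt, hmax⟩ := exists_maximal_ge_of_wellFoundedGT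
    (fun t : Submodule R L => ∀ y ∈ t, ∀ z ∈ t, ⁅y, z⁆ = 0) (R ∙ x) <| by
      simpa using lie_eq_zero_of_mem_sup_span_singleton (t := (⊥ : Submodule R L)) (y := x)
        (by simp) (by simp)
  refine ⟨t, hxt (Submodule.mem_span_singleton_self x), fun y => ⟨fun hy z hz => hmax.1 z hz y hy,
    fun hy => ?_⟩⟩
  exact hmax.2 (lie_eq_zero_of_mem_sup_span_singleton hmax.1 hy) le_sup_left
    (Submodule.mem_sup_right (Submodule.mem_span_singleton_self y))

end SelfCentralizing

section WeightVector

variable {L : Type*} [LieRing L] [LieAlgebra ℝ L] {t : Submodule ℝ L}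

/-- A real form of the notion of root vector: `z` lies in the sum of the root spaces of `±α` for
some linear form `α` on `t`, on which the products `ad x ∘ ad y` with `x, y ∈ t` act by the scalars
`α x * α y`. Since `ad x` itself is skew-symmetric for a compact real form, it has no real
eigenvectors. -/
def IsWeightVector (t : Submodule ℝ L) (z : L) : Prop :=
  ∀ x ∈ t, ∀ y ∈ t, ∃ c : ℝ, ⁅x, ⁅y, z⁆⁆ = c • z

theorem IsWeightVector.lie (ht : IsSelfCentralizing t) {z : L} (hz : IsWeightVector t z) {x : L}
    (hx : x ∈ t) : IsWeightVector t ⁅x, z⁆ := by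
  intro v hv w hw
  obtain ⟨c, hc⟩ := hz v hv w hw
  refine ⟨c, ?_⟩
  rw [lie_lie_comm_of_lie_eq_zero (ht.lie_eq_zero hw hx),
    lie_lie_comm_of_lie_eq_zero (ht.lie_eq_zero hv hx), hc, lie_smul]

end WeightVector

namespace IsInvariantInner

variable {L : Type*} [LieRing L] [LieAlgebra ℝ L] {β : LinearMap.BilinForm ℝ L}
  (hβ : IsInvariantInner L β)
include hβ

theorem apply_lie_left (x y z : L) : β ⁅x, y⁆ z = β x ⁅y, z⁆ := by
  rw [← lie_skew, map_neg, LinearMap.neg_apply, hβ.lieInvariant, neg_neg]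

theorem lie_eq_zero_of_lie_lie_eq_zero {x y : L} (h : ⁅x, ⁅x, y⁆⁆ = 0) : ⁅x, y⁆ = 0 :=
  hβ.eq_zero_of_self <| by rw [hβ.lieInvariant, h, map_zero, neg_zero]

section WeightVector

variable {t : Submodule ℝ L}

theorem exists_ne_zero_lie_lie_eq_smul {z : L} (hz : IsWeightVector t z) {x : L} (hx : x ∈ t)
    (hxz : ⁅x, z⁆ ≠ 0) : ∃ c : ℝ, c ≠ 0 ∧ ⁅x, ⁅x, z⁆⁆ = c • z := by
  obtain ⟨c, hc⟩ := hz x hx x hx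
  refine ⟨c, ?_, hc⟩
  rintro rfl
  exact hxz (hβ.lie_eq_zero_of_lie_lie_eq_zero (by rw [hc, zero_smul]))

variable (ht : IsSelfCentralizing t)
include ht

theorem eq_zero_of_forall_isWeightVector [FiniteDimensional ℝ L] {N : Type*} [AddCommGroup N]
    [Module ℝ N] {f : L →ₗ[ℝ] N} (hf : ∀ z, IsWeightVector t z → f z = 0) : f = 0 := by
  let T (p : t × t) : Module.End ℝ L := LieAlgebra.ad ℝ L p.1 * LieAlgebra.ad ℝ L p.2
  have hcomm (x y : t) : Commute (LieAlgebra.ad ℝ L (x : L)) (LieAlgebra.ad ℝ L (y : L)) :=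
    LinearMap.ext (lie_lie_comm_of_lie_eq_zero (ht.lie_eq_zero x.2 y.2))
  have hT (p : t × t) : β.IsSelfAdjoint (T p) := fun x y => by
    simp only [T, Module.End.mul_apply, LieAlgebra.ad_apply]
    rw [hβ.lieInvariant, hβ.lieInvariant, neg_neg,
      lie_lie_comm_of_lie_eq_zero (ht.lie_eq_zero p.2.2 p.1.2)]
  have htop := hβ.iSup_iInf_eigenspace_eq_top hT fun p q =>
    ((hcomm _ _).mul_right (hcomm _ _)).mul_left ((hcomm _ _).mul_right (hcomm _ _))
  refine LinearMap.ker_eq_top.1 (top_unique (htop ▸ iSup_le fun χ z hz => hf z fun x hx y hy =>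
    ⟨χ (⟨x, hx⟩, ⟨y, hy⟩), ?_⟩))
  exact Module.End.mem_eigenspace_iff.1 ((Submodule.mem_iInf _).1 hz (⟨x, hx⟩, ⟨y, hy⟩))

theorem exists_lie_eq_smul_lie {z : L} (hz : IsWeightVector t z) {x : L} (hx : x ∈ t)
    (hxz : ⁅x, z⁆ ≠ 0) {y : L} (hy : y ∈ t) : ∃ c : ℝ, ⁅y, z⁆ = c • ⁅x, z⁆ := by
  obtain ⟨q, hq0, hq⟩ := hβ.exists_ne_zero_lie_lie_eq_smul hz hx hxz
  obtain ⟨r, hr⟩ := hz x hx y hy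
  have hxy := ht.lie_eq_zero hx hy
  have hmul : q • ⁅y, z⁆ = r • ⁅x, z⁆ := by
    rw [← lie_smul, ← hq, ← lie_lie_comm_of_lie_eq_zero hxy, ← lie_lie_comm_of_lie_eq_zero hxy, hr,
      lie_smul]
  exact ⟨q⁻¹ * r, by rw [mul_smul, ← hmul, inv_smul_smul₀ hq0]⟩

theorem lie_lie_mem_of_isWeightVector {z : L} (hz : IsWeightVector t z) {x : L} (hx : x ∈ t) :
    ⁅z, ⁅x, z⁆⁆ ∈ t := by
  by_cases hxz : ⁅x, z⁆ = 0
  · rw [hxz, lie_zero]; exact zero_mem t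
  refine (ht _).2 fun y hy => ?_
  obtain ⟨a, ha⟩ := hβ.exists_lie_eq_smul_lie ht hz hx hxz hy
  obtain ⟨q, hq⟩ := hz y hy x hx
  rw [leibniz_lie, ha, hq, smul_lie, lie_self, smul_zero, zero_add, lie_smul, lie_self, smul_zero]

end WeightVector

end IsInvariantInner

/-! ### The Bianchi identity for endomorphisms of a simple Lie algebra -/

section Simple

variable {R L N : Type*} [CommRing R] [LieRing L] [LieAlgebra R L] [LieAlgebra.IsSimple R L]
  [AddCommGroup N] [Module R N]

theorem linearMap_ext_lie {f g : L →ₗ[R] N} (h : ∀ x y : L, f ⁅x, y⁆ = g ⁅x, y⁆) : f = g := by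
  have hne : ⁅(⊤ : LieIdeal R L), (⊤ : LieIdeal R L)⁆ ≠ ⊥ := by
    rw [Ne, LieSubmodule.lie_eq_bot_iff]
    exact fun hlie => LieAlgebra.IsSimple.non_abelian R (L := L)
      ⟨fun x y => hlie x (LieSubmodule.mem_top x) y (LieSubmodule.mem_top y)⟩
  have htop := congrArg LieSubmodule.toSubmodule
    ((LieAlgebra.IsSimple.eq_bot_or_eq_top _).resolve_left hne)
  rw [LieSubmodule.lieIdeal_oper_eq_linear_span', LieSubmodule.top_toSubmodule] at htop
  refine LinearMap.ext_on htop ?_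
  rintro _ ⟨x, -, y, -, rfl⟩
  exact h x y

end Simple

/-- The first Bianchi identity for the curvature tensor `(x, y, z) ↦ ⁅S ⁅x, y⁆, z⁆` determined by an
endomorphism `S` of a Lie algebra. -/
def SatisfiesBianchi {R L : Type*} [CommRing R] [LieRing L] [LieAlgebra R L]
    (S : Module.End R L) : Prop :=
  ∀ x y z : L, ⁅S ⁅x, y⁆, z⁆ + ⁅S ⁅y, z⁆, x⁆ + ⁅S ⁅z, x⁆, y⁆ = 0

namespace IsInvariantInner

variable {L : Type*} [LieRing L] [LieAlgebra ℝ L] {β : LinearMap.BilinForm ℝ L}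
  (hβ : IsInvariantInner L β)
include hβ

section Schur

variable [LieAlgebra.IsSimple ℝ L]

theorem isSelfAdjoint_of_lieModuleHom (f : L →ₗ⁅ℝ, L⁆ L) : β.IsSelfAdjoint f := by
  have hf (x y : L) : ⁅f x, y⁆ = ⁅x, f y⁆ := by
    rw [← lie_skew, ← f.map_lie, ← f.map_lie, ← lie_skew x y, map_neg]
  intro x z
  refine LinearMap.congr_fun (linearMap_ext_lie (f := β.flip z ∘ₗ (f : L →ₗ[ℝ] L))
    (g := β.flip (f z)) fun x y => ?_) x
  calc β (f ⁅x, y⁆) z = β x ⁅f y, z⁆ := by rw [f.map_lie, hβ.apply_lie_left]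
    _ = β ⁅x, y⁆ (f z) := by rw [hf, hβ.apply_lie_left]

theorem exists_eq_smul_of_lieModuleHom [FiniteDimensional ℝ L] (f : L →ₗ⁅ℝ, L⁆ L) :
    ∃ c : ℝ, ∀ x, f x = c • x :=
  hβ.exists_eq_smul_of_isSelfAdjoint (hβ.isSelfAdjoint_of_lieModuleHom f)

theorem exists_eq_smul_of_lie_self [FiniteDimensional ℝ L] {S : Module.End ℝ L}
    (hS : β.IsSelfAdjoint S) (hlie : ∀ x, ⁅S x, x⁆ = 0) : ∃ c : ℝ, ∀ x, S x = c • x := by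
  have hcomm (x y : L) : ⁅S x, y⁆ = ⁅x, S y⁆ := by
    have h := hlie (x + y)
    rw [map_add, lie_add, add_lie, add_lie, hlie, hlie, zero_add, add_zero] at h
    rw [← lie_skew x, eq_neg_iff_add_eq_zero, add_comm, h]
  let f : L →ₗ⁅ℝ, L⁆ L :=
    { S with
      map_lie' := fun {x y} => hβ.ext fun z => by
        calc β (S ⁅x, y⁆) z = -β y ⁅x, S z⁆ := by rw [hS, hβ.lieInvariant]
          _ = β ⁅x, S y⁆ z := by rw [← hcomm, ← hcomm, hβ.lieInvariant] }
  exact hβ.exists_eq_smul_of_isSelfAdjoint (f := f) hS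

end Schur

section Bianchi

variable {S : Module.End ℝ L} {t : Submodule ℝ L}

theorem apply_lie_lie_eq_zero (hS : β.IsSelfAdjoint S) (hb : SatisfiesBianchi S)
    (ht : IsSelfCentralizing t) {x y z w : L} (hz : IsWeightVector t z) (hx : x ∈ t) (hw : w ∈ t)
    (hxy : ⁅x, y⁆ = 0) (hxz : ⁅x, z⁆ ≠ 0) : β (S z) ⁅y, ⁅w, y⁆⁆ = 0 := by
  obtain ⟨q, hq0, hq⟩ := hβ.exists_ne_zero_lie_lie_eq_smul hz hx hxz
  have hxwy : ⁅x, ⁅w, y⁆⁆ = 0 := by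
    rw [lie_lie_comm_of_lie_eq_zero (ht.lie_eq_zero hx hw), hxy, lie_zero]
  have hSx : ⁅x, S ⁅y, ⁅w, y⁆⁆⁆ = 0 := by
    have h := hb y ⁅w, y⁆ x
    rwa [hxy, map_zero, zero_lie, add_zero, ← lie_skew ⁅w, y⁆ x, hxwy, neg_zero, map_zero,
      zero_lie, add_zero, ← lie_skew, neg_eq_zero] at h
  have h : q * β (S z) ⁅y, ⁅w, y⁆⁆ = 0 := by
    rw [hS, ← smul_eq_mul, ← LinearMap.smul_apply, ← map_smul, ← hq, hβ.lieInvariant, hSx,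
      map_zero, neg_zero]
  exact (mul_eq_zero.1 h).resolve_left hq0

variable [FiniteDimensional ℝ L]

theorem eq_zero_of_forall_lie_lie_eq_zero [LieAlgebra.IsSimple ℝ L] {u x : L} (hu : u ≠ 0)
    (hx : ∀ y : L, ⁅x, ⁅u, y⁆⁆ = 0) : x = 0 := by
  -- The centralizer of the range of `ad u` is an ideal: both the range of `ad u` and its orthogonal
  -- complement, the kernel of `ad u`, preserve it.
  let I : LieIdeal ℝ L :=
    { carrier := {w | ∀ y : L, ⁅w, ⁅u, y⁆⁆ = 0}
      add_mem' := fun ha hb y => by rw [add_lie, ha y, hb y, add_zero]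
      zero_mem' := fun y => zero_lie _
      smul_mem' := fun c a ha y => by rw [smul_lie, ha y, smul_zero]
      lie_mem := fun {v w} hw y => by
        obtain ⟨_, ⟨p, rfl⟩, k, hk, rfl⟩ := Submodule.mem_sup.1
          ((hβ.isCompl_orthogonal (LinearMap.range (LieAlgebra.ad ℝ L u))).sup_eq_top ▸
            Submodule.mem_top : v ∈ _)
        have hku : ⁅k, u⁆ = 0 := by
          rw [← lie_skew, neg_eq_zero]
          refine hβ.ext fun z => ?_
          rw [map_zero, LinearMap.zero_apply, hβ.lieInvariant, hβ.isSymm.eq, neg_eq_zero]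
          exact hk _ ⟨z, rfl⟩
        have hpw : ⁅⁅u, p⁆, w⁆ = 0 := by rw [← lie_skew, hw p, neg_zero]
        rw [LieAlgebra.ad_apply, add_lie, hpw, zero_add, lie_lie, hw y, lie_zero, zero_sub,
          lie_lie_comm_of_lie_eq_zero hku, hw, neg_zero] }
  rcases LieAlgebra.IsSimple.eq_bot_or_eq_top I with hI | hI
  · exact (LieSubmodule.mem_bot x).1 (hI ▸ hx : x ∈ (⊥ : LieIdeal ℝ L))
  · have hlie (y z : L) : ⁅⁅u, y⁆, z⁆ = 0 := by
      rw [← lie_skew, (hI ▸ LieSubmodule.mem_top z : z ∈ I) y, neg_zero]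
    refine absurd (LieModule.ext_of_isFaithful (R := ℝ) L fun y => ?_) hu
    exact LieModule.ext_of_isFaithful (R := ℝ) L fun z => by rw [hlie, zero_lie, zero_lie]

theorem lie_lie_eq_zero_of_apply_eq (hS : β.IsSelfAdjoint S) (hb : SatisfiesBianchi S)
    (ht : IsSelfCentralizing t) {z h₀ : L} (hz : IsWeightVector t z) (hh₀ : h₀ ∈ t)
    (h₀z : ⁅h₀, z⁆ ≠ 0) {u : L} (hu : u ∈ t) (hSu : ∀ w ∈ t, β (S z) w = β u w)
    {x : L} (hx : x ∈ t) (hxz : ⁅x, z⁆ = 0) (y : L) : ⁅x, ⁅u, y⁆⁆ = 0 := by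
  suffices h : LieAlgebra.ad ℝ L x ∘ₗ LieAlgebra.ad ℝ L u = 0 from LinearMap.congr_fun h y
  refine hβ.eq_zero_of_forall_isWeightVector ht fun y hy => ?_
  change ⁅x, ⁅u, y⁆⁆ = 0
  by_cases hxy : ⁅x, y⁆ = 0
  · rw [lie_lie_comm_of_lie_eq_zero (ht.lie_eq_zero hx hu), hxy, lie_zero]
  obtain ⟨c, hc⟩ := hβ.exists_lie_eq_smul_lie ht hy hx hxy hh₀
  obtain ⟨d, hd⟩ := hβ.exists_lie_eq_smul_lie ht hy hx hxy hu
  -- `h₀ - c • x` kills `y` but not `z`.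
  have hSz : β (S z) ⁅y, ⁅x, y⁆⁆ = 0 :=
    hβ.apply_lie_lie_eq_zero hS hb ht hz (t.sub_mem hh₀ (t.smul_mem c hx)) hx
      (by rw [sub_lie, smul_lie, hc, sub_self])
      (by rwa [sub_lie, smul_lie, hxz, smul_zero, sub_zero])
  rw [hSu _ (hβ.lie_lie_mem_of_isWeightVector ht hy hx), ← hβ.apply_lie_left, hd, map_smul,
    LinearMap.smul_apply, smul_eq_mul] at hSz
  have hd0 : d = 0 := (mul_eq_zero.1 hSz).resolve_right fun h => hxy (hβ.eq_zero_of_self h)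
  rw [hd, hd0, zero_smul, lie_zero]

theorem exists_lie_eq_zero_notMem_span (hrank : 2 ≤ LieAlgebra.rank ℝ L) (x : L) :
    ∃ y, ⁅x, y⁆ = 0 ∧ y ∉ ℝ ∙ x := by
  by_contra! hspan
  have hker (n : ℕ) (y : L) (hy : (LieAlgebra.ad ℝ L x ^ n) y = 0) : ⁅x, y⁆ = 0 := by
    induction n generalizing y with
    | zero => rw [show y = 0 from hy, lie_zero]
    | succ n ih => exact hβ.lie_eq_zero_of_lie_lie_eq_zero (ih _ hy)
  have hle : (LieSubalgebra.engel ℝ x).toSubmodule ≤ ℝ ∙ x := fun y hy => by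
    obtain ⟨n, hn⟩ := (LieSubalgebra.mem_engel_iff ℝ x y).1 hy
    exact hspan y (hker n y hn)
  have := (LieAlgebra.rank_le_finrank_engel ℝ x).trans <|
    (Submodule.finrank_mono hle).trans
      (by simpa using finrank_span_le_card (R := ℝ) ({x} : Set L))
  omega

variable [LieAlgebra.IsSimple ℝ L]

theorem apply_eq_zero_of_isWeightVector (hS : β.IsSelfAdjoint S) (hb : SatisfiesBianchi S)
    (ht : IsSelfCentralizing t) (hrank : ∀ x ∈ t, ∃ y ∈ t, y ∉ ℝ ∙ x)
    {z h₀ : L} (hz : IsWeightVector t z) (hh₀ : h₀ ∈ t) (h₀z : ⁅h₀, z⁆ ≠ 0) {w : L} (hw : w ∈ t) :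
    β (S z) w = 0 := by
  obtain ⟨u, hu, hSu⟩ := hβ.exists_mem_apply_eq t (S z)
  suffices hu0 : u = 0 by rw [hSu w hw, hu0, map_zero, LinearMap.zero_apply]
  obtain ⟨y, hy, hyh₀⟩ := hrank h₀ hh₀
  obtain ⟨c, hc⟩ := hβ.exists_lie_eq_smul_lie ht hz hh₀ h₀z hy
  by_contra hu0
  have hyc : y - c • h₀ = 0 := hβ.eq_zero_of_forall_lie_lie_eq_zero hu0 <|
    hβ.lie_lie_eq_zero_of_apply_eq hS hb ht hz hh₀ h₀z hu hSu (t.sub_mem hy (t.smul_mem c hh₀))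
      (by rw [sub_lie, smul_lie, hc, sub_self])
  exact hyh₀ (Submodule.mem_span_singleton.2 ⟨c, (sub_eq_zero.1 hyc).symm⟩)

theorem lie_apply_self_eq_zero (hS : β.IsSelfAdjoint S) (hb : SatisfiesBianchi S)
    (hcent : ∀ x : L, ∃ y, ⁅x, y⁆ = 0 ∧ y ∉ ℝ ∙ x) (x : L) : ⁅S x, x⁆ = 0 := by
  obtain ⟨t, hxt, ht⟩ := exists_isSelfCentralizing (R := ℝ) x
  have hrank : ∀ v ∈ t, ∃ w ∈ t, w ∉ ℝ ∙ v := by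
    intro v _
    by_contra! hspan
    obtain ⟨w, hvw, hw⟩ := hcent v
    refine hw (hspan w ((ht w).2 fun s hs => ?_))
    obtain ⟨a, rfl⟩ := Submodule.mem_span_singleton.1 (hspan s hs)
    rw [smul_lie, hvw, smul_zero]
  have hz : β (S x) ∘ₗ LieAlgebra.ad ℝ L x = 0 :=
    hβ.eq_zero_of_forall_isWeightVector ht fun z hz => by
      change β (S x) ⁅x, z⁆ = 0
      by_cases hxz : ⁅x, z⁆ = 0
      · rw [hxz, map_zero]
      rw [hS, hβ.isSymm.eq]
      exact hβ.apply_eq_zero_of_isWeightVector hS hb ht hrank (hz.lie ht hxt) hxt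
        (fun h => hxz (hβ.lie_eq_zero_of_lie_lie_eq_zero h)) hxt
  refine hβ.ext fun y => ?_
  rw [hβ.apply_lie_left, map_zero, LinearMap.zero_apply]
  exact LinearMap.congr_fun hz y

theorem exists_eq_smul_of_satisfiesBianchi (hS : β.IsSelfAdjoint S) (hb : SatisfiesBianchi S)
    (hcent : ∀ x : L, ∃ y, ⁅x, y⁆ = 0 ∧ y ∉ ℝ ∙ x) : ∃ c : ℝ, ∀ x, S x = c • x :=
  hβ.exists_eq_smul_of_lie_self hS (hβ.lie_apply_self_eq_zero hS hb hcent)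

end Bianchi

end IsInvariantInner

/-! ### Tensors as homomorphisms -/

section TensorHom

variable {K L M N : Type*} [Field K] [LieRing L] [LieAlgebra K L]
  [AddCommGroup M] [Module K M] [FiniteDimensional K M] [LieRingModule L M] [LieModule K L M]
  [AddCommGroup N] [Module K N] [LieRingModule L N] [LieModule K L N]
  {β : LinearMap.BilinForm K M}

/-- The isomorphism of representations `M ⊗ N ≅ Hom(M, N)` obtained by identifying `M` with its dual
through a nondegenerate invariant bilinear form `β`: it sends `m ⊗ n` to `x ↦ β m x • n`. -/
noncomputable def tensorHomEquiv (hβ : β.Nondegenerate) (hinv : β.lieInvariant L) :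
    M ⊗[K] N ≃ₗ⁅K, L⁆ (M →ₗ[K] N) :=
  let e := (TensorProduct.congr (β.toDual hβ) (LinearEquiv.refl K N)).trans
    (dualTensorHomEquiv K M N)
  { e with
    map_lie' := fun {x t} => by
      induction t using TensorProduct.induction_on with
      | zero => simp
      | tmul m n =>
        ext y
        simp [e, hinv x m y, LinearMap.BilinForm.toDual_def, sub_eq_neg_add,
          TensorProduct.LieModule.lie_tmul_right]
      | add s t hs ht => simp_all }

variable (hβ : β.Nondegenerate) (hinv : β.lieInvariant L)

theorem tensorHomEquiv_tmul (m x : M) (n : N) :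
    tensorHomEquiv hβ hinv (m ⊗ₜ n) x = β m x • n :=
  rfl

/-- Invariant tensors in `M ⊗ N` are the same as homomorphisms of representations `M → N`, for `M`
with a nondegenerate invariant bilinear form. -/
noncomputable def invariantTensorEquiv :
    LieModule.maxTrivSubmodule K L (M ⊗[K] N) ≃ₗ[K] (M →ₗ⁅K, L⁆ N) :=
  (LieModule.maxTrivEquiv (tensorHomEquiv hβ hinv)).toLinearEquiv.trans
    LieModule.maxTrivLinearMapEquivLieModuleHom

theorem invariantTensorEquiv_apply (τ : LieModule.maxTrivSubmodule K L (M ⊗[K] N)) (x : M) :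
    invariantTensorEquiv hβ hinv τ x = tensorHomEquiv hβ hinv (τ : M ⊗[K] N) x :=
  rfl

theorem apply_tensorHomEquiv_comm (hsymm : β.IsSymm) (t : M ⊗[K] M) (x y : M) :
    β (tensorHomEquiv hβ hinv (TensorProduct.comm K M M t) x) y =
      β x (tensorHomEquiv hβ hinv t y) := by
  induction t using TensorProduct.induction_on with
  | zero => simp
  | tmul a b => simp [tensorHomEquiv_tmul, hsymm.eq x b, mul_comm]
  | add s t hs ht => simp_all

end TensorHom

section SymmetricSquare

variable {L M : Type*} [LieRing L] [LieAlgebra ℝ L] [AddCommGroup M] [Module ℝ M]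
  [LieRingModule L M] [LieModule ℝ L M]

theorem mem_symSq {t : M ⊗[ℝ] M} : t ∈ symSq L M ↔ TensorProduct.comm ℝ M M t = t :=
  Iff.rfl

theorem mem_symSq_iff_isSelfAdjoint [FiniteDimensional ℝ M] {β : LinearMap.BilinForm ℝ M}
    (hβ : β.Nondegenerate) (hinv : β.lieInvariant L) (hsymm : β.IsSymm) {t : M ⊗[ℝ] M} :
    t ∈ symSq L M ↔ β.IsSelfAdjoint (tensorHomEquiv hβ hinv t) := by
  rw [mem_symSq]
  refine ⟨fun ht x y => ?_, fun ht => (tensorHomEquiv hβ hinv).injective <| LinearMap.ext fun x =>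
    LinearMap.ker_eq_bot.1 hβ.ker_eq_bot <| LinearMap.ext fun y => ?_⟩
  · rw [← apply_tensorHomEquiv_comm hβ hinv hsymm, ht]
  · rw [apply_tensorHomEquiv_comm hβ hinv hsymm, ht]

variable (L) (L' : Type*) {M' : Type*} [LieRing L'] [LieAlgebra ℝ L'] [AddCommGroup M']
  [Module ℝ M'] [LieRingModule L' M'] [LieModule ℝ L' M']

theorem map_congr_symSq (ι : M ≃ₗ[ℝ] M') :
    (symSq L M).toSubmodule.map (TensorProduct.congr ι ι : M ⊗[ℝ] M →ₗ[ℝ] M' ⊗[ℝ] M') =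
      (symSq L' M').toSubmodule := by
  ext t
  obtain ⟨s, rfl⟩ := (TensorProduct.congr ι ι).surjective t
  have hcomm : TensorProduct.comm ℝ M' M' (TensorProduct.congr ι ι s) =
      TensorProduct.congr ι ι (TensorProduct.comm ℝ M M s) :=
    (TensorProduct.map_comm _ _ s).symm
  rw [LieSubmodule.mem_toSubmodule, mem_symSq, hcomm, EmbeddingLike.apply_eq_iff_eq]
  exact (TensorProduct.congr ι ι).injective.mem_set_image

/-- The isomorphism of symmetric squares induced by a linear isomorphism. -/
noncomputable def symSqCongr (ι : M ≃ₗ[ℝ] M') : symSq L M ≃ₗ[ℝ] symSq L' M' :=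
  LinearEquiv.ofSubmodules (TensorProduct.congr ι ι) _ _ (map_congr_symSq L L' ι)

variable {L L'}

theorem symSqCongr_lie (ι : M ≃ₗ[ℝ] M') {x : L} {x' : L'} (hι : ∀ m, ι ⁅x, m⁆ = ⁅x', ι m⁆)
    (t : symSq L M) : symSqCongr L L' ι ⁅x, t⁆ = ⁅x', symSqCongr L L' ι t⁆ := by
  have key (s : M ⊗[ℝ] M) : TensorProduct.congr ι ι ⁅x, s⁆ = ⁅x', TensorProduct.congr ι ι s⁆ := by
    induction s using TensorProduct.induction_on with
    | zero => simp
    | tmul a b => simp [TensorProduct.LieModule.lie_tmul_right, hι]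
    | add a b ha hb => simp [ha, hb]
  exact Subtype.ext (key t)

end SymmetricSquare

/-! ### The isomorphism with the adjoint representation -/

section HomToAdjoint

variable {R L M N : Type*} [CommRing R] [LieRing L] [AddCommGroup M] [Module R M]
  [LieRingModule L M] [AddCommGroup N] [Module R N] [LieRingModule L N]

theorem lieModuleEquiv_map_lie (φ : M ≃ₗ⁅R, L⁆ N) (x : L) (m : M) : φ ⁅x, m⁆ = ⁅x, φ m⁆ :=
  φ.toLieModuleHom.map_lie x m

theorem injective_of_isIrreducible [LieModule.IsIrreducible R L M] {f : M →ₗ⁅R, L⁆ N}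
    (hf : f ≠ 0) : Function.Injective f :=
  (LieModuleHom.ker_eq_bot f).1 <| (eq_bot_or_eq_top f.ker).resolve_right fun htop =>
    hf <| LieModuleHom.ext fun m => f.mem_ker.1 (htop ▸ LieSubmodule.mem_top m)

theorem isSimple_of_lieModuleEquiv [LieAlgebra R L] [LieModule R L M]
    [LieModule.IsIrreducible R L M] [LieModule.IsFaithful R L M] (φ : M ≃ₗ⁅R, L⁆ L) :
    LieAlgebra.IsSimple R L where
  eq_bot_or_eq_top :=
    have : IsSimpleOrder (LieIdeal R L) :=
      (LieSubmodule.orderIsoMapComap φ).symm.isSimpleOrder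
    eq_bot_or_eq_top
  non_abelian _ := by
    have := LieModule.nontrivial_of_isIrreducible R L M
    obtain ⟨m, hm⟩ := exists_ne (0 : M)
    refine hm ((map_eq_zero_iff φ φ.injective).1 ?_)
    refine LieModule.ext_of_isFaithful (R := R) M fun m' => φ.injective ?_
    rw [zero_lie, map_zero, lieModuleEquiv_map_lie, trivial_lie_zero]

end HomToAdjoint

theorem IsInvariantInner.bijective_of_isIrreducible {L M : Type*} [LieRing L] [LieAlgebra ℝ L]
    [AddCommGroup M] [Module ℝ M] [LieRingModule L M] [LieModule ℝ L M]
    [LieModule.IsIrreducible ℝ L M] [FiniteDimensional ℝ L]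
    [LieModule.IsFaithful ℝ L M] {β : LinearMap.BilinForm ℝ L} (hβ : IsInvariantInner L β)
    {f : M →ₗ⁅ℝ, L⁆ L} (hf : f ≠ 0) : Function.Bijective f := by
  have hinj := injective_of_isIrreducible hf
  refine ⟨hinj, fun A => ?_⟩
  obtain ⟨_, ⟨n, rfl⟩, hA⟩ := hβ.exists_mem_apply_eq (f : M →ₗ[ℝ] L).range A
  have horth (m : M) : β (A - f n) (f m) = 0 := by
    rw [map_sub, LinearMap.sub_apply, sub_eq_zero]
    exact hA _ ⟨m, rfl⟩
  refine ⟨n, (LieModule.ext_of_isFaithful (R := ℝ) M fun m => sub_eq_zero.1 ?_).symm⟩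
  rw [← sub_lie, ← map_eq_zero_iff f hinj]
  refine hβ.eq_zero_of_self ?_
  calc β (f ⁅A - f n, m⁆) (f ⁅A - f n, m⁆)
      = β (A - f n) (f ⁅f m, ⁅A - f n, m⁆⁆) := by
        conv_lhs => rw [f.map_lie, hβ.apply_lie_left, ← f.map_lie, ← f.map_lie]
    _ = 0 := horth _

section Euclidean

variable {V : Type*} [NormedAddCommGroup V] [InnerProductSpace ℝ V]

theorem isInvariantInner_innerₗ (h : LieSubalgebra ℝ (so V)) : IsInvariantInner h (innerₗ V) where
  isSymm := ⟨fun X Y => real_inner_comm Y X⟩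
  pos _ hX := real_inner_self_pos.2 hX
  lieInvariant x := inner_so (x : so V)

variable [FiniteDimensional ℝ V]

theorem isInvariantInner_neg_traceForm {L : Type*} [LieRing L] [LieAlgebra ℝ L] [LieRingModule L V]
    [LieModule ℝ L V] [LieModule.IsFaithful ℝ L V]
    (hinv : LinearMap.BilinForm.lieInvariant L (innerₗ V)) :
    IsInvariantInner L (-LieModule.traceForm ℝ L V) where
  isSymm := ⟨fun x y => by simp [LieModule.traceForm_comm ℝ L V x y]⟩
  pos x hx := by
    let b := stdOrthonormalBasis ℝ V
    have hsum : (-LieModule.traceForm ℝ L V) x x = ∑ i, ‖⁅x, b i⁆‖ ^ 2 := by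
      simp only [LinearMap.neg_apply, LieModule.traceForm_apply_apply,
        LinearMap.trace_eq_sum_inner _ b, ← Finset.sum_neg_distrib]
      refine Finset.sum_congr rfl fun i _ => ?_
      rw [← real_inner_self_eq_norm_sq]
      exact (hinv x (b i) ⁅x, b i⁆).symm
    refine hsum ▸ (Finset.sum_nonneg fun i _ => sq_nonneg _).lt_of_ne' fun hzero => hx ?_
    refine (LieModule.toEnd_eq_zero_iff ℝ L V).1 (b.toBasis.ext fun i => ?_)
    simpa using (Finset.sum_eq_zero_iff_of_nonneg fun i _ => sq_nonneg _).1 hzero i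
      (Finset.mem_univ i)
  lieInvariant x y z := by
    simp [LieModule.traceForm_lieInvariant ℝ L V x y z]

variable {h : LieSubalgebra ℝ (so V)}

/-- The equivariant homomorphism `X ↦ τ_X` determined by an invariant tensor `τ ∈ (V ⊗ 𝔥)^𝔥`. -/
noncomputable def contractEquiv (h : LieSubalgebra ℝ (so V)) :
    LieModule.maxTrivSubmodule ℝ h (V ⊗[ℝ] h) ≃ₗ[ℝ] (V →ₗ⁅ℝ, h⁆ h) :=
  invariantTensorEquiv (isInvariantInner_innerₗ h).nondegenerate
    (isInvariantInner_innerₗ h).lieInvariant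

theorem contractEquiv_apply (τ : LieModule.maxTrivSubmodule ℝ h (V ⊗[ℝ] h)) (X : V) :
    contractEquiv h τ X = contract h τ X := by
  have heq : (tensorHomEquiv (isInvariantInner_innerₗ h).nondegenerate
      (isInvariantInner_innerₗ h).lieInvariant).toLinearEquiv.toLinearMap = contract h :=
    TensorProduct.ext' fun v A => LinearMap.ext fun X => (contract_tmul h v X A).symm
  exact (invariantTensorEquiv_apply _ _ τ X).trans congr($heq τ X)

theorem nonempty_lieModuleEquiv (hirr : LieModule.IsIrreducible ℝ h V)
    (hinv : LieModule.maxTrivSubmodule ℝ h (V ⊗[ℝ] h) ≠ ⊥) : Nonempty (V ≃ₗ⁅ℝ, h⁆ h) := by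
  have := (LieSubmodule.nontrivial_iff_ne_bot ℝ h _).2 hinv
  obtain ⟨τ, hτ⟩ := exists_ne (0 : LieModule.maxTrivSubmodule ℝ h (V ⊗[ℝ] h))
  let f := contractEquiv h τ
  have hf : f ≠ 0 := (map_ne_zero_iff _ (contractEquiv h).injective).2 hτ
  have hbij := (isInvariantInner_neg_traceForm
    (isInvariantInner_innerₗ h).lieInvariant).bijective_of_isIrreducible hf
  exact ⟨{ f, LinearEquiv.ofBijective (f : V →ₗ[ℝ] h) hbij with }⟩

theorem exists_tensor3_eq [LieAlgebra.IsSimple ℝ h] (φ : V ≃ₗ⁅ℝ, h⁆ h)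
    {τ : V ⊗[ℝ] h} (hτ : τ ∈ LieModule.maxTrivSubmodule ℝ h (V ⊗[ℝ] h)) :
    ∃ c : ℝ, ∀ X Y Z : V, tensor3 h τ X Y Z = c * canonicalForm h φ ![X, Y, Z] := by
  let f : V →ₗ⁅ℝ, h⁆ h := contractEquiv h ⟨τ, hτ⟩
  obtain ⟨c, hc⟩ := (isInvariantInner_neg_traceForm
    (isInvariantInner_innerₗ h).lieInvariant).exists_eq_smul_of_lieModuleHom
      (f.comp φ.symm.toLieModuleHom)
  have hτφ (X : V) : contract h τ X = c • φ X := by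
    rw [← contractEquiv_apply ⟨τ, hτ⟩, ← hc]
    exact congrArg f (φ.symm_apply_apply X).symm
  refine ⟨c, fun X Y Z => ?_⟩
  rw [tensor3, canonicalForm_apply, symm_lie, hτφ, smul_lie, real_inner_smul_left]

end Euclidean

/-! ### Curvature operators as endomorphisms -/

section FactorThroughBracket

variable {R L : Type*} [CommRing R] [LieRing L] [LieAlgebra R L] [LieAlgebra.IsSimple R L]

theorem surjective_toModuleHom_self :
    Function.Surjective (LieModule.toModuleHom R L L) := by
  rw [← LieModuleHom.coe_toLinearMap, ← LinearMap.range_eq_top,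
    ← Submodule.ker_mkQ (LinearMap.range _), LinearMap.ker_eq_top]
  refine linearMap_ext_lie fun x y => ?_
  simpa using ⟨x ⊗ₜ y, LieModule.toModuleHom_apply R L L x y⟩

theorem exists_isSelfAdjoint_apply_lie_eq {β : LinearMap.BilinForm R L} (hβ : β.Nondegenerate)
    (hsymm : β.IsSymm) {ρ : L →ₗ[R] L →ₗ[R] L}
    (hρ : ∀ x y z w, β (ρ x y) ⁅z, w⁆ = β (ρ z w) ⁅x, y⁆) :
    ∃ S : Module.End R L, β.IsSelfAdjoint S ∧ ∀ x y, S ⁅x, y⁆ = ρ x y := by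
  let b : L ⊗[R] L →ₗ[R] L := LieModule.toModuleHom R L L
  have hlift (t : L ⊗[R] L) (z w : L) : β (TensorProduct.lift ρ t) ⁅z, w⁆ = β (ρ z w) (b t) := by
    induction t using TensorProduct.induction_on with
    | zero => simp
    | tmul x y => simpa [b] using hρ x y z w
    | add s t hs ht => simp_all
  have hker : b.ker ≤ (TensorProduct.lift ρ).ker := fun t ht => by
    refine LinearMap.mem_ker.2 (hβ.1 _ fun q => LinearMap.congr_fun (g := 0) ?_ q)
    refine linearMap_ext_lie fun z w => ?_
    rw [hlift, LinearMap.mem_ker.1 ht, map_zero, LinearMap.zero_apply]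
  let S : Module.End R L := b.ker.liftQ (TensorProduct.lift ρ) hker ∘ₗ
    (b.quotKerEquivOfSurjective surjective_toModuleHom_self).symm
  have hS (x y : L) : S ⁅x, y⁆ = ρ x y := by
    have : (b.quotKerEquivOfSurjective surjective_toModuleHom_self).symm ⁅x, y⁆ =
        Submodule.Quotient.mk (x ⊗ₜ y) :=
      (LinearEquiv.symm_apply_eq _).2 (LieModule.toModuleHom_apply R L L x y).symm
    simp [S, this]
  refine ⟨S, fun p q => ?_, hS⟩
  have hadj : β ∘ₗ S = β.compl₂ S := linearMap_ext_lie fun x y => linearMap_ext_lie fun z w => by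
    simp [hS, hρ x y z w, hsymm.eq]
  exact congr($hadj p q)

end FactorThroughBracket

section EndTensor

variable {V : Type*} [NormedAddCommGroup V] [InnerProductSpace ℝ V] {h : LieSubalgebra ℝ (so V)}

/-- The inner product of `V` transported to `𝔥` along an isomorphism `φ : V ≅ 𝔥` of
representations. -/
noncomputable def transportedInner (φ : V ≃ₗ⁅ℝ, h⁆ h) : LinearMap.BilinForm ℝ h :=
  (innerₗ V).compl₁₂ φ.symm.toLinearEquiv.toLinearMap φ.symm.toLinearEquiv.toLinearMap

theorem isInvariantInner_transportedInner (φ : V ≃ₗ⁅ℝ, h⁆ h) :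
    IsInvariantInner h (transportedInner φ) :=
  (isInvariantInner_innerₗ h).comp φ.symm.injective (lieModuleEquiv_map_lie φ.symm)

theorem transportedInner_apply_map (φ : V ≃ₗ⁅ℝ, h⁆ h) (X Y : V) :
    transportedInner φ (φ X) (φ Y) = ⟪X, Y⟫ :=
  congr(⟪$(φ.symm_apply_apply X), $(φ.symm_apply_apply Y)⟫)

theorem inner_lie_eq_transportedInner (φ : V ≃ₗ⁅ℝ, h⁆ h) (A : h) (Z W : V) :
    ⟪⁅A, Z⁆, W⟫ = transportedInner φ A ⁅φ Z, φ W⁆ := by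
  rw [← transportedInner_apply_map φ, lieModuleEquiv_map_lie,
    (isInvariantInner_transportedInner φ).apply_lie_left]

/-- The `4`-tensor `(X, Y, Z) ↦ ⁅S ⁅X, Y⁆, Z⁆` determined by an endomorphism `S` of `𝔥`, where `V`
is identified with `𝔥` by `φ`. -/
noncomputable def endTensor (φ : V ≃ₗ⁅ℝ, h⁆ h) : Module.End ℝ h →ₗ[ℝ] Tensor4 V where
  toFun S := ((LieModule.toEnd ℝ h h : h →ₗ[ℝ] Module.End ℝ h).compl₁₂
    φ.toLinearEquiv.toLinearMap φ.toLinearEquiv.toLinearMap).compr₂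
    ((LieModule.toEnd ℝ h V : h →ₗ[ℝ] Module.End ℝ V) ∘ₗ S)
  map_add' S T := by ext; simp
  map_smul' c S := by ext; simp

theorem endTensor_apply (φ : V ≃ₗ⁅ℝ, h⁆ h) (S : Module.End ℝ h) (X Y Z : V) :
    endTensor φ S X Y Z = ⁅S ⁅φ X, φ Y⁆, Z⁆ :=
  rfl

theorem endTensor_lie (φ : V ≃ₗ⁅ℝ, h⁆ h) (x : h) (S : Module.End ℝ h) :
    endTensor φ ⁅x, S⁆ = ⁅x, endTensor φ S⁆ := by
  ext X Y Z
  have hact (R : Tensor4 V) : ⁅x, R⁆ X Y Z =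
      ⁅x, R X Y Z⁆ - R ⁅x, X⁆ Y Z - R X ⁅x, Y⁆ Z - R X Y ⁅x, Z⁆ :=
    lie_tensor4_apply (x : so V) R X Y Z
  rw [hact]
  simp only [endTensor_apply, LieHom.lie_apply, lieModuleEquiv_map_lie]
  rw [leibniz_lie x (φ X), leibniz_lie x (S _), map_add, sub_lie, add_lie]
  abel

theorem endTensor_injective [LieAlgebra.IsSimple ℝ h] (φ : V ≃ₗ⁅ℝ, h⁆ h) :
    Function.Injective (endTensor φ) := fun S T hST =>
  linearMap_ext_lie fun x y => LieModule.ext_of_isFaithful (R := ℝ) V fun Z => by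
    obtain ⟨X, rfl⟩ := φ.surjective x
    obtain ⟨Y, rfl⟩ := φ.surjective y
    exact congr($hST X Y Z)

theorem inner_endTensor (φ : V ≃ₗ⁅ℝ, h⁆ h) (S : Module.End ℝ h) (X Y Z W : V) :
    ⟪endTensor φ S X Y Z, W⟫ = transportedInner φ (S ⁅φ X, φ Y⁆) ⁅φ Z, φ W⁆ :=
  inner_lie_eq_transportedInner φ _ Z W

theorem endTensor_mem_symOf (φ : V ≃ₗ⁅ℝ, h⁆ h) {S : Module.End ℝ h}
    (hS : (transportedInner φ).IsSelfAdjoint S) : endTensor φ S ∈ symOf h := by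
  refine ⟨⟨fun X Y Z W => ?_, fun X Y Z W => ?_, fun X Y Z W => ?_⟩, fun X Y =>
    ⟨_, (S ⁅φ X, φ Y⁆).2, fun Z => rfl⟩⟩ <;> simp only [inner_endTensor]
  · rw [← lie_skew (φ Y), map_neg, map_neg, LinearMap.neg_apply, neg_neg]
  · rw [← lie_skew (φ Z), map_neg]
  · rw [hS, (isInvariantInner_transportedInner φ).isSymm.eq]

theorem exists_eq_lie_of_mem_symOf {R : Tensor4 V} (hR : R ∈ symOf h) :
    ∃ ρ : V →ₗ[ℝ] V →ₗ[ℝ] h, ∀ X Y Z, R X Y Z = ⁅ρ X Y, Z⁆ := by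
  let i : h →ₗ[ℝ] Module.End ℝ V := LieModule.toEnd ℝ h V
  obtain ⟨l, hl⟩ := i.exists_leftInverse_of_injective
    (LinearMap.ker_eq_bot.2 fun A B hAB => Subtype.ext (Subtype.ext hAB))
  refine ⟨R.compr₂ l, fun X Y Z => ?_⟩
  obtain ⟨A, hA, hRA⟩ := hR.2 X Y
  have hRi : R X Y = i ⟨A, hA⟩ := LinearMap.ext hRA
  have hlA : l (i ⟨A, hA⟩) = ⟨A, hA⟩ := congr($hl _)
  rw [LinearMap.compr₂_apply, hRi, hlA]
  rfl

theorem exists_endTensor_eq [LieAlgebra.IsSimple ℝ h] (φ : V ≃ₗ⁅ℝ, h⁆ h) {R : Tensor4 V}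
    (hR : R ∈ symOf h) :
    ∃ S : Module.End ℝ h, (transportedInner φ).IsSelfAdjoint S ∧ endTensor φ S = R := by
  obtain ⟨ρ, hρ⟩ := exists_eq_lie_of_mem_symOf hR
  have hβ := isInvariantInner_transportedInner φ
  have hpair (X Y Z W : V) : transportedInner φ (ρ X Y) ⁅φ Z, φ W⁆ =
      transportedInner φ (ρ Z W) ⁅φ X, φ Y⁆ := by
    rw [← inner_lie_eq_transportedInner, ← inner_lie_eq_transportedInner, ← hρ, ← hρ]
    exact hR.1.2.2 X Y Z W
  let ψ : h →ₗ[ℝ] V := φ.symm.toLinearEquiv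
  obtain ⟨S, hS, hSρ⟩ := exists_isSelfAdjoint_apply_lie_eq hβ.nondegenerate hβ.isSymm
    (ρ := ρ.compl₁₂ ψ ψ) fun x y z w => by
      simpa [ψ] using hpair (φ.symm x) (φ.symm y) (φ.symm z) (φ.symm w)
  refine ⟨S, hS, LinearMap.ext fun X => LinearMap.ext fun Y => LinearMap.ext fun Z => ?_⟩
  rw [endTensor_apply, hSρ, hρ]
  simp [ψ]

end EndTensor

section CurvOf

variable {V : Type*} [NormedAddCommGroup V] [InnerProductSpace ℝ V] {h : LieSubalgebra ℝ (so V)}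

theorem bianchi_endTensor_iff (φ : V ≃ₗ⁅ℝ, h⁆ h) (S : Module.End ℝ h) :
    (∀ X Y Z, bianchi (endTensor φ S) X Y Z = 0) ↔ SatisfiesBianchi S := by
  have hmap (X Y Z : V) : φ (bianchi (endTensor φ S) X Y Z) =
      ⁅S ⁅φ X, φ Y⁆, φ Z⁆ + ⁅S ⁅φ Y, φ Z⁆, φ X⁆ + ⁅S ⁅φ Z, φ X⁆, φ Y⁆ := by
    simp only [bianchi, endTensor_apply, map_add, lieModuleEquiv_map_lie]
  refine ⟨fun hb x y z => ?_, fun hb X Y Z => φ.injective ?_⟩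
  · obtain ⟨X, rfl⟩ := φ.surjective x
    obtain ⟨Y, rfl⟩ := φ.surjective y
    obtain ⟨Z, rfl⟩ := φ.surjective z
    rw [← hmap, hb, map_zero]
  · rw [hmap, hb, map_zero]

theorem endTensor_mem_curvOf_iff (φ : V ≃ₗ⁅ℝ, h⁆ h) {S : Module.End ℝ h}
    (hS : (transportedInner φ).IsSelfAdjoint S) :
    endTensor φ S ∈ curvOf h ↔ SatisfiesBianchi S :=
  have hmem := endTensor_mem_symOf φ hS
  ⟨fun hR => (bianchi_endTensor_iff φ S).1 hR.1.2,
    fun hb => ⟨⟨hmem.1, (bianchi_endTensor_iff φ S).2 hb⟩, hmem⟩⟩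

theorem satisfiesBianchi_one {R L : Type*} [CommRing R] [LieRing L] [LieAlgebra R L] :
    SatisfiesBianchi (1 : Module.End R L) := fun x y z => by
  simp only [Module.End.one_apply]
  rw [← lie_skew ⁅x, y⁆, ← lie_skew ⁅y, z⁆, ← lie_skew ⁅z, x⁆, ← neg_add, ← neg_add, neg_eq_zero,
    ← lie_jacobi x y z]
  abel

variable [FiniteDimensional ℝ V] [LieAlgebra.IsSimple ℝ h]

theorem curvOf_eq_span_endTensor_one (φ : V ≃ₗ⁅ℝ, h⁆ h) (hrank : 2 ≤ LieAlgebra.rank ℝ h) :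
    (curvOf h).toSubmodule = ℝ ∙ endTensor φ 1 := by
  refine le_antisymm (fun R hR => ?_) ?_
  · obtain ⟨S, hS, rfl⟩ := exists_endTensor_eq φ hR.2
    obtain ⟨c, hc⟩ := (isInvariantInner_transportedInner φ).exists_eq_smul_of_satisfiesBianchi hS
      ((endTensor_mem_curvOf_iff φ hS).1 hR)
      ((isInvariantInner_transportedInner φ).exists_lie_eq_zero_notMem_span hrank)
    rw [show S = c • 1 from LinearMap.ext hc, map_smul]
    exact Submodule.smul_mem _ c (Submodule.mem_span_singleton_self _)
  · rw [Submodule.span_singleton_le_iff_mem]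
    exact (endTensor_mem_curvOf_iff φ fun _ _ => rfl).2 satisfiesBianchi_one

theorem isTrivial_curvOf_and_nonempty_equiv (φ : V ≃ₗ⁅ℝ, h⁆ h)
    (hrank : 2 ≤ LieAlgebra.rank ℝ h) :
    LieModule.IsTrivial h (curvOf h) ∧ Nonempty (curvOf h ≃ₗ[ℝ] ℝ) := by
  have hspan := curvOf_eq_span_endTensor_one φ hrank
  refine ⟨⟨fun x R => Subtype.ext ?_⟩, ?_⟩
  · obtain ⟨c, hc⟩ := Submodule.mem_span_singleton.1 (hspan.le R.2)
    change ⁅x, (R : Tensor4 V)⁆ = 0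
    have hx : ⁅x, (1 : Module.End ℝ h)⁆ = 0 := by ext; simp
    rw [← hc, ← map_smul, ← endTensor_lie, lie_smul, hx, smul_zero, map_zero]
  · have : Nontrivial h := LieAlgebra.IsSimple.nontrivial ℝ h
    have hne : endTensor φ 1 ≠ 0 := fun h0 =>
      one_ne_zero (endTensor_injective φ (h0.trans (map_zero _).symm))
    exact ⟨(LinearEquiv.ofEq _ _ hspan).trans
      (LinearEquiv.toSpanNonzeroSingleton ℝ (Tensor4 V) _ hne).symm⟩

theorem map_symSq_eq_symOf (φ : V ≃ₗ⁅ℝ, h⁆ h) :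
    (symSq h h).toSubmodule.map (endTensor φ ∘ₗ
      (tensorHomEquiv (isInvariantInner_transportedInner φ).nondegenerate
        (isInvariantInner_transportedInner φ).lieInvariant).toLinearEquiv.toLinearMap) =
      (symOf h).toSubmodule := by
  have hβ := isInvariantInner_transportedInner φ
  have hiff := fun t => mem_symSq_iff_isSelfAdjoint (t := t) hβ.nondegenerate hβ.lieInvariant
    hβ.isSymm
  ext R
  constructor
  · rintro ⟨t, ht, rfl⟩
    exact endTensor_mem_symOf φ ((hiff t).1 ht)
  · intro hR
    obtain ⟨S, hS, rfl⟩ := exists_endTensor_eq φ hR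
    obtain ⟨t, rfl⟩ := (tensorHomEquiv hβ.nondegenerate hβ.lieInvariant).surjective S
    exact ⟨t, (hiff t).2 hS, rfl⟩

/-- The isomorphism `Sym² 𝔥 ≅ Sym 𝔥` of representations. Symmetric tensors on `𝔥` become
symmetric endomorphisms, hence curvature operators by `endTensor`. -/
noncomputable def symSqEquivSymOf (φ : V ≃ₗ⁅ℝ, h⁆ h) : symSq h h ≃ₗ⁅ℝ, h⁆ symOf h :=
  let e := tensorHomEquiv (isInvariantInner_transportedInner φ).nondegenerate
    (isInvariantInner_transportedInner φ).lieInvariant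
  { (Submodule.equivMapOfInjective (endTensor φ ∘ₗ e.toLinearEquiv.toLinearMap)
      ((endTensor_injective φ).comp e.injective) (symSq h h).toSubmodule).trans
      (LinearEquiv.ofEq _ _ (map_symSq_eq_symOf φ)) with
    map_lie' {x t} := Subtype.ext <|
      congr(endTensor φ $(lieModuleEquiv_map_lie e x t)).trans (endTensor_lie φ x (e t)) }

end CurvOf

/-! ### Dimension three -/

section LowDimension

variable {V : Type*} [NormedAddCommGroup V] [InnerProductSpace ℝ V]

theorem mem_so_iff {f : Module.End ℝ V} : f ∈ so V ↔ ∀ X Y, ⟪f X, Y⟫ = -⟪X, f Y⟫ := by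
  refine (LinearMap.mem_skewAdjointSubmodule (B := innerₗ V) (f := f)).trans
    (forall₂_congr fun X Y => ?_)
  change ⟪f X, Y⟫ = ⟪X, -f Y⟫ ↔ _
  rw [inner_neg_right]

/-- The cyclic sum `⟪bianchi R X Y Z, W⟫`, as an alternating `4`-form. It is the component of
`R ∈ Sym² Λ² V` in `Λ⁴ V`. -/
def bianchiForm {R : Tensor4 V} (hR : R ∈ symSqLambda V) : V [⋀^Fin 4]→ₗ[ℝ] ℝ where
  toFun v := ⟪bianchi R (v 0) (v 1) (v 2), v 3⟫
  map_update_add' := by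
    intro inst m i x y
    cases Subsingleton.elim inst (instDecidableEqFin 4)
    fin_cases i <;> simp [bianchi, Function.update, inner_add_left, inner_add_right] <;> ring
  map_update_smul' := by
    intro inst m i c x
    cases Subsingleton.elim inst (instDecidableEqFin 4)
    fin_cases i <;>
      simp [bianchi, Function.update, inner_add_left, inner_smul_left, inner_smul_right] <;> ring
  map_eq_zero_of_eq' := by
    obtain ⟨hfst, hsnd, hswap⟩ := hR
    have h01 (X Z W : V) : ⟪bianchi R X X Z, W⟫ = 0 := by
      simp only [bianchi, inner_add_left]
      linarith [hfst X X Z W, hfst X Z X W]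
    have h23 (X Y Z : V) : ⟪bianchi R X Y Z, Z⟫ = 0 := by
      simp only [bianchi, inner_add_left]
      linarith [hsnd X Y Z Z, hswap Y Z X Z, hfst X Z Y Z]
    have hrot (X Y Z : V) : bianchi R X Y Z = bianchi R Y Z X := by
      simp only [bianchi]; abel
    have h12 (X Y W : V) : ⟪bianchi R X Y Y, W⟫ = 0 := by rw [hrot, h01]
    have h02 (X Y W : V) : ⟪bianchi R X Y X, W⟫ = 0 := by rw [hrot, h12]
    have h13 (X Y Z : V) : ⟪bianchi R X Y Z, Y⟫ = 0 := by rw [hrot, hrot, h23]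
    have h03 (X Y Z : V) : ⟪bianchi R X Y Z, X⟫ = 0 := by rw [hrot, h23]
    intro v i j hij hne
    fin_cases i <;> fin_cases j <;> grind

variable [FiniteDimensional ℝ V]

theorem curv_eq_symSqLambda_of_finrank_lt (hV : Module.finrank ℝ V < 4) :
    curv V = symSqLambda V := by
  refine le_antisymm (fun R hR => hR.1) fun R hR => ⟨hR, fun X Y Z => ?_⟩
  refine ext_inner_right ℝ fun W => ?_
  rw [inner_zero_left]
  refine (bianchiForm hR).map_linearDependent ![X, Y, Z, W] fun hli => ?_
  simpa using hli.fintype_card_le_finrank.trans_lt hV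

theorem finrank_so_le : Module.finrank ℝ (so V) ≤ (Module.finrank ℝ V).choose 2 := by
  let b := stdOrthonormalBasis ℝ V
  let F : so V →ₗ[ℝ] (Σ j : Fin (Module.finrank ℝ V), Fin j) → ℝ :=
    LinearMap.pi fun p => (innerₗ V (b p.1)) ∘ₗ LinearMap.applyₗ (b (p.2.castLE p.1.2.le)) ∘ₗ
      (so V).toSubmodule.subtype
  have hF : Function.Injective F := (injective_iff_map_eq_zero F).2 fun A hA => by
    have hlt (i j) (hij : i < j) : ⟪b j, ⁅A, b i⁆⟫ = 0 := congr_fun hA ⟨j, ⟨i, hij⟩⟩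
    refine Subtype.ext (b.toBasis.ext fun i =>
      InnerProductSpace.ext_inner_left_basis b.toBasis fun j => ?_)
    change ⟪b.toBasis j, ⁅A, b.toBasis i⁆⟫ = ⟪_, (0 : V)⟫
    rw [b.coe_toBasis, inner_zero_right]
    have hskew := inner_so A (b j) (b i)
    rw [real_inner_comm] at hskew
    rcases lt_trichotomy i j with hij | rfl | hij
    · exact hlt i j hij
    · linarith
    · rw [hlt j i hij] at hskew
      linarith
  calc Module.finrank ℝ (so V) ≤ Module.finrank ℝ ((Σ j : Fin (Module.finrank ℝ V), Fin j) → ℝ) :=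
        LinearMap.finrank_le_finrank_of_injective hF
    _ = ∑ j ∈ Finset.range (Module.finrank ℝ V), j := by
        rw [Module.finrank_fintype_fun_eq_card, Fintype.card_sigma, Finset.sum_range]
        simp only [Fintype.card_fin]
    _ = (Module.finrank ℝ V).choose 2 := by rw [Finset.sum_range_id, Nat.choose_two_right]

end LowDimension

section CrossProduct

open scoped Matrix

/-- The endomorphism `X ↦ v × X` of `ℝ³`, as an element of `so(3)` depending linearly on `v`. -/
noncomputable def crossSo : EuclideanSpace ℝ (Fin 3) →ₗ[ℝ] so (EuclideanSpace ℝ (Fin 3)) where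
  toFun v := ⟨(WithLp.linearEquiv 2 ℝ (Fin 3 → ℝ)).symm.conj (crossProduct v.ofLp),
    mem_so_iff.2 fun X Y => by
      change Y.ofLp ⬝ᵥ v.ofLp ⨯₃ X.ofLp = -(v.ofLp ⨯₃ Y.ofLp ⬝ᵥ X.ofLp)
      rw [dotProduct_comm (_ ⨯₃ _), triple_product_permutation,
        triple_product_permutation X.ofLp, ← cross_anticomm, dotProduct_neg]⟩
  map_add' v w := Subtype.ext (by simp)
  map_smul' c v := Subtype.ext (by simp)

theorem crossSo_lie (v X : EuclideanSpace ℝ (Fin 3)) :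
    ⁅crossSo v, X⁆ = WithLp.toLp 2 (v.ofLp ⨯₃ X.ofLp) :=
  rfl

theorem crossSo_injective : Function.Injective crossSo :=
  (injective_iff_map_eq_zero _).2 fun v hv => by
    have hX (X : Fin 3 → ℝ) : v.ofLp ⨯₃ X = 0 :=
      congr((⁅$hv, WithLp.toLp 2 X⁆ : EuclideanSpace ℝ (Fin 3)).ofLp)
    have h₀ := hX ![1, 0, 0]
    have h₁ := hX ![0, 1, 0]
    ext i
    fin_cases i <;> simp_all [cross_apply]

theorem crossSo_lie_crossSo (v w : EuclideanSpace ℝ (Fin 3)) :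
    crossSo ⁅crossSo v, w⁆ = ⁅crossSo v, crossSo w⁆ := by
  refine Subtype.ext (LinearMap.ext fun X => ?_)
  change ⁅crossSo ⁅crossSo v, w⁆, X⁆ = ⁅⁅crossSo v, crossSo w⁆, X⁆
  simp only [lie_lie, crossSo_lie, cross_cross, WithLp.toLp_sub]

/-- The isomorphism `ℝ³ ≅ so(3)` given by the cross product. -/
noncomputable def crossEquiv : EuclideanSpace ℝ (Fin 3) ≃ₗ[ℝ] so (EuclideanSpace ℝ (Fin 3)) :=
  crossSo.linearEquivOfInjective crossSo_injective <|
    (LinearMap.finrank_le_finrank_of_injective crossSo_injective).antisymm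
      (by simpa using finrank_so_le (V := EuclideanSpace ℝ (Fin 3)))

theorem crossEquiv_lie (A : so (EuclideanSpace ℝ (Fin 3))) (v : EuclideanSpace ℝ (Fin 3)) :
    crossEquiv ⁅A, v⁆ = ⁅A, crossEquiv v⁆ := by
  obtain ⟨w, rfl⟩ := crossEquiv.surjective A
  exact crossSo_lie_crossSo w v

theorem finrank_eq_three_of_lieEquiv_so {L : Type*} [LieRing L] [LieAlgebra ℝ L]
    (e : L ≃ₗ⁅ℝ⁆ so (EuclideanSpace ℝ (Fin 3))) : Module.finrank ℝ L = 3 := by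
  rw [e.toLinearEquiv.finrank_eq, ← crossEquiv.finrank_eq, finrank_euclideanSpace_fin]

variable {V : Type*} [NormedAddCommGroup V] [InnerProductSpace ℝ V]

theorem symOf_top :
    (symOf (⊤ : LieSubalgebra ℝ (so V))).toSubmodule = (symSqLambda V).toSubmodule :=
  le_antisymm (fun _ hR => hR.1) fun R hR => ⟨hR, fun X Y =>
    ⟨⟨R X Y, mem_so_iff.2 fun Z W => by rw [hR.2.1, real_inner_comm]⟩, LieSubalgebra.mem_top _,
      fun _ => rfl⟩⟩

variable [FiniteDimensional ℝ V] {h : LieSubalgebra ℝ (so V)}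

theorem symOf_eq_curv_of_finrank_eq_three (hV : Module.finrank ℝ V = 3)
    (hh : Module.finrank ℝ h = 3) : (symOf h).toSubmodule = (curv V).toSubmodule := by
  have hso : Module.finrank ℝ (so V) ≤ 3 := finrank_so_le.trans_eq (by rw [hV]; rfl)
  have htop : h = ⊤ := (LieSubalgebra.toSubmodule_inj _ _).1 <|
    Submodule.eq_top_of_finrank_eq ((Submodule.finrank_le _).antisymm (hso.trans_eq hh.symm))
  rw [curv_eq_symSqLambda_of_finrank_lt (by omega), ← symOf_top]
  subst htop
  rfl

theorem symOf_eq_curv_of_lieEquiv_so (φ : V ≃ₗ⁅ℝ, h⁆ h)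
    (e : h ≃ₗ⁅ℝ⁆ so (EuclideanSpace ℝ (Fin 3))) :
    (symOf h).toSubmodule = (curv V).toSubmodule :=
  have hh : Module.finrank ℝ h = 3 := finrank_eq_three_of_lieEquiv_so e
  symOf_eq_curv_of_finrank_eq_three (φ.toLinearEquiv.finrank_eq.trans hh) hh

theorem curvOf_eq_curv_of_lieEquiv_so (φ : V ≃ₗ⁅ℝ, h⁆ h)
    (e : h ≃ₗ⁅ℝ⁆ so (EuclideanSpace ℝ (Fin 3))) :
    (curvOf h).toSubmodule = (curv V).toSubmodule :=
  inf_eq_left.2 (symOf_eq_curv_of_lieEquiv_so φ e).ge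

theorem exists_curvOf_equiv_symSq [LieAlgebra.IsSimple ℝ h] (φ : V ≃ₗ⁅ℝ, h⁆ h)
    (e : h ≃ₗ⁅ℝ⁆ so (EuclideanSpace ℝ (Fin 3))) :
    ∃ f : curvOf h ≃ₗ[ℝ] symSq (so (EuclideanSpace ℝ (Fin 3))) (EuclideanSpace ℝ (Fin 3)),
      ∀ (x : h) (R : curvOf h), f ⁅x, R⁆ = ⁅e x, f R⁆ := by
  have hcurv : curvOf h = symOf h := LieSubmodule.toSubmodule_injective <|
    inf_eq_right.2 (symOf_eq_curv_of_lieEquiv_so φ e).le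
  let ι : h ≃ₗ[ℝ] EuclideanSpace ℝ (Fin 3) := e.toLinearEquiv.trans crossEquiv.symm
  have hι (x y : h) : ι ⁅x, y⁆ = ⁅e x, ι y⁆ := crossEquiv.injective <| by
    rw [crossEquiv_lie]
    simp only [ι, LinearEquiv.trans_apply, LinearEquiv.apply_symm_apply]
    exact e.map_lie x y
  have g : symOf h ≃ₗ⁅ℝ, h⁆ symSq h h := (symSqEquivSymOf φ).symm
  rw [hcurv]
  let f := symSqCongr h (so (EuclideanSpace ℝ (Fin 3))) ι
  exact ⟨g.toLinearEquiv.trans f, fun x R =>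
    (congrArg f (lieModuleEquiv_map_lie g x R)).trans (symSqCongr_lie ι (hι x) (g R))⟩

end CrossProduct

end SkewCurv

theorem mainTheorem10 {V : Type*} [NormedAddCommGroup V] [InnerProductSpace ℝ V]
    [FiniteDimensional ℝ V] (h : LieSubalgebra ℝ (SkewCurv.so V))
    (hirr : LieModule.IsIrreducible ℝ h V)
    (hinv : LieModule.maxTrivSubmodule ℝ h (V ⊗[ℝ] h) ≠ ⊥) :
    (LieAlgebra.IsSimple ℝ h ∧ Nonempty (V ≃ₗ⁅ℝ, h⁆ h)) ∧
    (2 ≤ LieAlgebra.rank ℝ h →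
      LieModule.IsTrivial h (SkewCurv.curvOf h) ∧ Nonempty (SkewCurv.curvOf h ≃ₗ[ℝ] ℝ)) ∧
    (∀ e : h ≃ₗ⁅ℝ⁆ SkewCurv.so (EuclideanSpace ℝ (Fin 3)),
      (SkewCurv.curvOf h).toSubmodule = (SkewCurv.curv V).toSubmodule ∧
      ∃ f : SkewCurv.curvOf h ≃ₗ[ℝ]
          SkewCurv.symSq (SkewCurv.so (EuclideanSpace ℝ (Fin 3))) (EuclideanSpace ℝ (Fin 3)),
        ∀ (x : h) (R : SkewCurv.curvOf h), f ⁅x, R⁆ = ⁅e x, f R⁆) ∧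
    (∀ (φ : V ≃ₗ⁅ℝ, h⁆ h), ∀ τ ∈ LieModule.maxTrivSubmodule ℝ h (V ⊗[ℝ] h),
      ∃ c : ℝ, ∀ X Y Z : V,
        SkewCurv.tensor3 h τ X Y Z = c * SkewCurv.canonicalForm h φ ![X, Y, Z]) := by
  obtain ⟨φ⟩ := SkewCurv.nonempty_lieModuleEquiv hirr hinv
  have hsimple := SkewCurv.isSimple_of_lieModuleEquiv φ
  exact ⟨⟨hsimple, ⟨φ⟩⟩, SkewCurv.isTrivial_curvOf_and_nonempty_equiv φ,
    fun e => ⟨SkewCurv.curvOf_eq_curv_of_lieEquiv_so φ e, SkewCurv.exists_curvOf_equiv_symSq φ e⟩,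
    fun ψ _ hτ => SkewCurv.exists_tensor3_eq ψ hτ⟩
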